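/- Let $K$ be a finite simplicial complex of dimension $n$, let $f_p(K)$ be the number of its $p$-dimensional simplices, and let $\nu\in[0,1]$. Equip the group $\mathcal C^0(K)$ of simplicial $0$-cochains of $K$ with $\mathbb Z/2\mathbb Z$-coefficients with the product probability measure $\mu_\nu$ under which, independently at each vertex, a cochain takes the value $0$ with probability $\nu$ and the value $1$ with probability $1-\nu$. For $\epsilon\in\mathcal C^0(K)$ let $V_\epsilon$ be the subcomplex of the first barycentric subdivision $\mathrm{Sd}(K)$ dual to the coboundary $d\epsilon$: its simplices are the faces of the simplices $[\hat\sigma_0,\dots,\hat\sigma_j]$ of $\mathrm{Sd}(K)$ (where $\sigma_0<\dots<\sigma_j$ are simplices of $K$, each a proper face of the next, and $\hat\sigma$ denotes the barycenter of $\sigma$) such that $\dim\sigma_0=1$ and $\langle d\epsilon,\sigma_0\rangle\neq0$. Let $b_i(\cdot)$ be the $i$-th Betti number with $\mathbb Z/2\mathbb Z$-coefficients, let $\chi(\cdot)=\sum_i(-1)^ib_i(\cdot)$ be the Euler characteristic, and set $$\mathbb E_\nu(b_i)=\int_{\mathcal C^0(K)}b_i(V_\epsilon)\,d\mu_\nu(\epsilon),\qquad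 \mathbb E_\nu(\chi)=\int_{\mathcal C^0(K)}\chi(V_\epsilon)\,d\mu_\nu(\epsilon).$$ Then, for every $i\in\{0,\dots,n-1\}$, $$\mathbb E_\nu(b_i)\le f_{i+1}(K)\bigl(1-\nu^{i+2}-(1-\nu)^{i+2}\bigr),$$ and $$\mathbb E_\nu(\chi)+\chi(K)=\sum_{i=0}^n(-1)^i\bigl(\nu^{i+1}+(1-\nu)^{i+1}\bigr)f_i(K).$$ -/

import Mathlib

open MeasureTheory

namespace RandomSubcomplex

universe u

variable {ι : Type u}

/-- The `p`-dimensional simplices of `K`, i.e. its faces with `p + 1` vertices. -/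
def Simplex (K : PreAbstractSimplicialComplex ι) (p : ℕ) : Type u :=
  {σ : Finset ι // σ ∈ K.faces ∧ σ.card = p + 1}

instance (K : PreAbstractSimplicialComplex ι) (p : ℕ) [Finite K.faces] :
    Finite (Simplex K p) :=
  Finite.of_injective (fun σ => (⟨σ.1, σ.2.1⟩ : K.faces)) fun _ _ h =>
    Subtype.ext (congrArg (fun x : K.faces => x.1) h)

/-- The number `f_p(K)` of `p`-dimensional simplices of `K`. -/
noncomputable def faceNumber (K : PreAbstractSimplicialComplex ι) (p : ℕ) : ℕ :=
  Nat.card (Simplex K p)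

/-- `K` has dimension `n`: `n` is the maximum of the dimensions of its simplices. -/
def HasDimension (K : PreAbstractSimplicialComplex ι) (n : ℕ) : Prop :=
  Nonempty (Simplex K n) ∧ ∀ σ ∈ K.faces, σ.card ≤ n + 1

open Classical in
/-- The facet (codimension one face) of a `(p + 1)`-simplex opposite to one of its vertices. -/
noncomputable def Simplex.facet {K : PreAbstractSimplicialComplex ι} {p : ℕ}
    (τ : Simplex K (p + 1)) (v : {v // v ∈ τ.1}) : Simplex K p :=
  ⟨τ.1.erase v.1, by
    have hcard : (τ.1.erase v.1).card = p + 1 := by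
      rw [Finset.card_erase_of_mem v.2, τ.2.2]; rfl
    exact ⟨(K.isRelLowerSet_faces τ.2.1).2 (Finset.erase_subset _ _)
      (Finset.card_pos.mp (by omega)), hcard⟩⟩

/-! Simplicial homology with `ℤ/2ℤ` coefficients. -/

/-- Simplicial `p`-chains with `ℤ/2ℤ` coefficients. -/
abbrev Chain (K : PreAbstractSimplicialComplex ι) (p : ℕ) : Type u :=
  Simplex K p →₀ ZMod 2

/-- The boundary operator `∂ : C_{p+1}(K) → C_p(K)`: a simplex is sent to the sum of its facets. -/
noncomputable def boundary (K : PreAbstractSimplicialComplex ι) (p : ℕ) :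
    Chain K (p + 1) →ₗ[ZMod 2] Chain K p :=
  Finsupp.linearCombination (ZMod 2)
    fun τ : Simplex K (p + 1) => ∑ v ∈ τ.1.attach, Finsupp.single (τ.facet v) (1 : ZMod 2)

/-- The `p`-cycles; every `0`-chain is a cycle. -/
noncomputable def cycles (K : PreAbstractSimplicialComplex ι) :
    (p : ℕ) → Submodule (ZMod 2) (Chain K p)
  | 0 => ⊤
  | p + 1 => LinearMap.ker (boundary K p)

/-- The `p`-boundaries. -/
noncomputable def boundaries (K : PreAbstractSimplicialComplex ι) (p : ℕ) :
    Submodule (ZMod 2) (Chain K p) :=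
  LinearMap.range (boundary K p)

noncomputable instance (K : PreAbstractSimplicialComplex ι) (p : ℕ) :
    AddCommGroup (cycles K p) :=
  Submodule.addCommGroup (cycles K p)

/-- The simplicial homology group `H_p(K; ℤ/2ℤ)`, cycles modulo boundaries. -/
abbrev Homology (K : PreAbstractSimplicialComplex ι) (p : ℕ) : Type u :=
  cycles K p ⧸ (boundaries K p).submoduleOf (cycles K p)

/-- The Betti number `b_p(K) = dim H_p(K; ℤ/2ℤ)`. -/
noncomputable def betti (K : PreAbstractSimplicialComplex ι) (p : ℕ) : ℕ :=
  Module.finrank (ZMod 2) (Homology K p)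

/-- The Euler characteristic `χ(K) = ∑_i (-1)^i b_i(K)` (a finite sum when `K` is finite). -/
noncomputable def eulerChar (K : PreAbstractSimplicialComplex ι) : ℤ :=
  ∑ᶠ i : ℕ, (-1 : ℤ) ^ i * (betti K i : ℤ)

/-! Cochains, the barycentric subdivision and the dual subcomplexes. -/

/-- Simplicial `p`-cochains with `ℤ/2ℤ` coefficients. -/
abbrev Cochain (K : PreAbstractSimplicialComplex ι) (p : ℕ) : Type u :=
  Simplex K p → ZMod 2

/-- The coboundary `d : C^p(K) → C^{p+1}(K)`; `⟨dε, τ⟩` is the sum of `ε` on the facets of `τ`. -/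
noncomputable def coboundary {K : PreAbstractSimplicialComplex ι} {p : ℕ}
    (ε : Cochain K p) : Cochain K (p + 1) :=
  fun τ => ∑ v ∈ τ.1.attach, ε (τ.facet v)

/-- The first barycentric subdivision `Sd(K)`. A simplex `σ` of `K` stands for its barycenter,
and the simplices of `Sd(K)` are the nonempty finite sets of simplices of `K` which are totally
ordered by inclusion. -/
def barycentricSubdivision (K : PreAbstractSimplicialComplex ι) :
    PreAbstractSimplicialComplex (Finset ι) where
  faces := {c | c.Nonempty ∧ (∀ σ ∈ c, σ ∈ K.faces) ∧
    IsChain (fun σ τ : Finset ι => σ ⊆ τ) (c : Set (Finset ι))}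
  isRelLowerSet_faces := fun _ hc =>
    ⟨hc.1, fun _ hbc hb => ⟨hb, fun σ hσ => hc.2.1 σ (hbc hσ),
      fun _ hx _ hy hxy => hc.2.2 (hbc hx) (hbc hy) hxy⟩⟩

/-- The subcomplex `V_ε` of `Sd(K)` dual to the cocycle `dε`, for `ε ∈ C^{k-1}(K)` with
`k = p + 1`: its simplices are the nonempty faces of the simplices `[σ₀, …, σᵢ]` of `Sd(K)`,
`σ₀ < … < σᵢ`, such that `dim σ₀ = k` and `⟨dε, σ₀⟩ ≠ 0`. -/
def dualSubcomplex {K : PreAbstractSimplicialComplex ι} {p : ℕ} (ε : Cochain K p) :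
    PreAbstractSimplicialComplex (Finset ι) where
  faces := {s | s.Nonempty ∧ ∃ c ∈ (barycentricSubdivision K).faces, s ⊆ c ∧
    ∃ σ₀ : Simplex K (p + 1), σ₀.1 ∈ c ∧ (∀ σ ∈ c, σ₀.1 ⊆ σ) ∧ coboundary ε σ₀ ≠ 0}
  isRelLowerSet_faces := fun _ hs =>
    ⟨hs.1, fun _ hbs hb => by
      obtain ⟨_, c, hc, hsc, hσ⟩ := hs
      exact ⟨hb, c, hc, Finset.Subset.trans hbs hsc, hσ⟩⟩

/-! The random cochain. -/

/-- The probability measure on `ℤ/2ℤ` giving mass `ν` to `0` and `1 - ν` to `1`. -/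
noncomputable def bernoulliLaw (ν : ℝ) : Measure (ZMod 2) :=
  ENNReal.ofReal ν • Measure.dirac 0 + ENNReal.ofReal (1 - ν) • Measure.dirac 1

open Classical in
/-- The product probability measure `μ_ν` on `C^p(K)`, for finite `K`: independently on each
`p`-simplex the cochain is `0` with probability `ν` and `1` with probability `1 - ν`. -/
noncomputable def cochainLaw (K : PreAbstractSimplicialComplex ι) [Finite K.faces] (p : ℕ)
    (ν : ℝ) : Measure (Cochain K p) :=
  letI : Fintype (Simplex K p) := Fintype.ofFinite _
  Measure.pi fun _ => bernoulliLaw ν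

/-- The expected value `𝔼_ν(b_i)` of the `i`-th Betti number of `V_ε` for `ε ∈ C^p(K)`. -/
noncomputable def expectedBetti (K : PreAbstractSimplicialComplex ι) [Finite K.faces] (p : ℕ)
    (ν : ℝ) (i : ℕ) : ℝ :=
  ∫ ε : Cochain K p, (betti (dualSubcomplex ε) i : ℝ) ∂(cochainLaw K p ν)

/-- The expected value `𝔼_ν(χ)` of the Euler characteristic of `V_ε` for `ε ∈ C^p(K)`. -/
noncomputable def expectedEulerChar (K : PreAbstractSimplicialComplex ι) [Finite K.faces] (p : ℕ)
    (ν : ℝ) : ℝ :=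
  ∫ ε : Cochain K p, (eulerChar (dualSubcomplex ε) : ℝ) ∂(cochainLaw K p ν)

end RandomSubcomplex

/-
`V_ε` is the order complex of the poset of those faces of `K` on which `ε` is not constant. Adding
these faces one at a time, by increasing dimension, each face `σ` contributes a cone over the order
complex of its proper nonconstant faces. The latter is a homology sphere of dimension `|σ| - 3`,
where `|σ|` is the number of vertices: if `|σ| > 2`, then `ε` agrees on two vertices `v` and `w`
of `σ`, and removing `σ ∖ v` from the poset leaves a contractible one (`ρ ↦ ρ ∪ v` retracts it onto
the `ρ` that contain `v`, and these retract onto the `ρ` in which no other vertex has the value of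
`v`, which have a greatest element because `w` may be dropped from `σ`), while the link of `σ ∖ v`
is the sphere that belongs to `σ ∖ v`. Hence `σ` contributes one cell of dimension `|σ| - 2`. The
rank of a block triangular matrix is at least the sum of the ranks of its diagonal blocks, which
gives the weak Morse inequalities for these cells: `b_i(V_ε)` is at most the number of nonconstant
`(i + 1)`-simplices. It remains to take expectations, as a face with `k` vertices is nonconstant
with probability `1 - ν ^ k - (1 - ν) ^ k`.
-/

namespace RandomSubcomplex

open Finset

section MatrixRank

variable {R m m₁ m₂ n n₁ n₂ : Type*} [Field R]

theorem rank_add_rank_le_rank_fromBlocks [Finite m₁] [Finite m₂] [Fintype n₁] [Fintype n₂]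
    (A : Matrix m₁ n₁ R) (B : Matrix m₁ n₂ R) (D : Matrix m₂ n₂ R) :
    A.rank + D.rank ≤ (Matrix.fromBlocks A B 0 D).rank := by
  have := Fintype.ofFinite m₁
  have := Fintype.ofFinite m₂
  let V := LinearMap.range (Matrix.fromBlocks A B 0 D).mulVecLin
  let lower : V →ₗ[R] (m₂ → R) := LinearMap.funLeft R R Sum.inr ∘ₗ V.subtype
  let upper : LinearMap.ker lower →ₗ[R] (m₁ → R) :=
    LinearMap.funLeft R R Sum.inl ∘ₗ V.subtype ∘ₗ (LinearMap.ker lower).subtype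
  have rank_D_le : D.rank ≤ Module.finrank R (LinearMap.range lower) := by
    refine Submodule.finrank_mono ?_
    rintro _ ⟨y, rfl⟩
    refine ⟨⟨_, Sum.elim 0 y, rfl⟩, ?_⟩
    ext i
    simp [lower, LinearMap.funLeft, Matrix.fromBlocks_mulVec]
  have rank_A_le : A.rank ≤ Module.finrank R (LinearMap.ker lower) := by
    refine le_trans (Submodule.finrank_mono ?_) (LinearMap.finrank_range_le upper)
    rintro _ ⟨x, rfl⟩
    refine ⟨⟨⟨_, Sum.elim x 0, rfl⟩, ?_⟩, ?_⟩ <;> ext i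
    · simp [lower, LinearMap.funLeft, Matrix.fromBlocks_mulVec]
    · simp [upper, LinearMap.funLeft, Matrix.fromBlocks_mulVec]
  calc A.rank + D.rank
      ≤ Module.finrank R (LinearMap.ker lower) + Module.finrank R (LinearMap.range lower) :=
        add_le_add rank_A_le rank_D_le
    _ = (Matrix.fromBlocks A B 0 D).rank := by
        rw [add_comm, lower.finrank_range_add_finrank_ker]
        rfl

theorem rank_submatrix_add_rank_submatrix_le [Finite m] [Finite m₁] [Finite m₂] [Fintype n]
    [Fintype n₁] [Fintype n₂] (A : Matrix m n R) (r₁ : m₁ → m) (r₂ : m₂ → m) (c₁ : n₁ → n)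
    (c₂ : n₂ → n) (h : ∀ i j, A (r₂ i) (c₁ j) = 0) :
    (A.submatrix r₁ c₁).rank + (A.submatrix r₂ c₂).rank ≤ A.rank := by
  have hA : A.submatrix (Sum.elim r₁ r₂) (Sum.elim c₁ c₂) =
      Matrix.fromBlocks (A.submatrix r₁ c₁) (A.submatrix r₁ c₂) 0 (A.submatrix r₂ c₂) := by
    ext (i | i) (j | j) <;> simp [h]
  exact (rank_add_rank_le_rank_fromBlocks _ (A.submatrix r₁ c₂) _).trans
    (hA ▸ A.rank_submatrix_le _ _)

end MatrixRank

section Families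

variable {α : Type*}

/-- The number of members of `L`, counted with sign; it is the opposite of the reduced Euler
characteristic if `L` is a simplicial complex listed together with its empty face. -/
def signedCard (L : Finset (Finset α)) : ℤ := ∑ s ∈ L, (-1) ^ #s

theorem sum_slice {M : Type*} [AddCommMonoid M] {L : Finset (Finset α)} {N : ℕ}
    (hN : ∀ s ∈ L, #s < N) (g : ℕ → M) :
    ∑ s ∈ L, g #s = ∑ d ∈ range N, #(L.slice d) • g d := by
  rw [← sum_fiberwise_of_maps_to fun s hs => mem_range.2 (hN s hs)]
  refine sum_congr rfl fun d _ => ?_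
  rw [sum_congr rfl fun s hs => by rw [(mem_filter.1 hs).2], sum_const]
  rfl

variable [DecidableEq α]

/-- The matrix of the boundary map, with `ℤ/2ℤ` coefficients, from the members of `L` with `d + 1`
elements to those with `d` elements. -/
def boundaryMatrix (L : Finset (Finset α)) (d : ℕ) :
    Matrix (L.slice d) (L.slice (d + 1)) (ZMod 2) :=
  Matrix.of fun s t => if s.1 ⊆ t.1 then 1 else 0

/-- The rank of the boundary map defined on the members of `L` with `d` elements. -/
noncomputable def boundaryRank (L : Finset (Finset α)) : ℕ → ℕ
  | 0 => 0
  | d + 1 => (boundaryMatrix L d).rank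

/-- The reduced Betti number of `L` in dimension `d - 1`, if `L` is a simplicial complex listed
together with its empty face. The degree `d` is a cardinality rather than a dimension, so that the
empty face has degree `0`. For an arbitrary family this is a difference of ranks, possibly
negative. -/
noncomputable def reducedBetti (L : Finset (Finset α)) (d : ℕ) : ℤ :=
  #(L.slice d) - boundaryRank L d - boundaryRank L (d + 1)

theorem boundaryRank_eq_zero {L : Finset (Finset α)} {N : ℕ} (hN : ∀ s ∈ L, #s < N) :
    boundaryRank L N = 0 := by
  cases N with
  | zero => rfl
  | succ d =>
    have : IsEmpty (L.slice (d + 1)) :=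
      ⟨fun t => (hN _ (mem_slice.1 t.2).1).ne (mem_slice.1 t.2).2⟩
    exact Nat.le_zero.1 ((boundaryMatrix L d).rank_le_card_width.trans_eq Fintype.card_eq_zero)

theorem sum_range_reducedBetti {L : Finset (Finset α)} {N : ℕ} (hN : ∀ s ∈ L, #s < N) :
    ∑ d ∈ range N, (-1) ^ d * reducedBetti L d = signedCard L := by
  have partial_sum (M : ℕ) : ∑ d ∈ range M, (-1) ^ d * reducedBetti L d =
      ∑ d ∈ range M, #(L.slice d) • (-1 : ℤ) ^ d + (-1) ^ M * boundaryRank L M := by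
    induction M with
    | zero => simp [boundaryRank]
    | succ M ih =>
      rw [sum_range_succ, sum_range_succ, ih, reducedBetti, nsmul_eq_mul]
      ring
  rw [partial_sum, boundaryRank_eq_zero hN, signedCard, sum_slice hN]
  simp

theorem nonMemberSubfamily_slice (L : Finset (Finset α)) (p : α) (d : ℕ) :
    (L.slice d).nonMemberSubfamily p = (L.nonMemberSubfamily p).slice d :=
  filter_comm ..

theorem memberSubfamily_slice_succ (L : Finset (Finset α)) (p : α) (d : ℕ) :
    (L.slice (d + 1)).memberSubfamily p = (L.memberSubfamily p).slice d := by
  ext s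
  simp only [mem_memberSubfamily, mem_slice]
  by_cases hs : p ∈ s <;> simp [hs]

theorem memberSubfamily_slice_zero (L : Finset (Finset α)) (p : α) :
    (L.slice 0).memberSubfamily p = ∅ := by
  ext s
  simp [mem_slice]

theorem card_slice_succ (L : Finset (Finset α)) (p : α) (d : ℕ) :
    #(L.slice (d + 1)) =
      #((L.nonMemberSubfamily p).slice (d + 1)) + #((L.memberSubfamily p).slice d) := by
  rw [← nonMemberSubfamily_slice, ← memberSubfamily_slice_succ, add_comm #_,
    card_memberSubfamily_add_card_nonMemberSubfamily]

theorem card_slice_zero (L : Finset (Finset α)) (p : α) :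
    #(L.slice 0) = #((L.nonMemberSubfamily p).slice 0) := by
  rw [← card_memberSubfamily_add_card_nonMemberSubfamily p, memberSubfamily_slice_zero,
    nonMemberSubfamily_slice, card_empty, zero_add]

theorem signedCard_eq_sub (L : Finset (Finset α)) (p : α) :
    signedCard L = signedCard (L.nonMemberSubfamily p) - signedCard (L.memberSubfamily p) := by
  have sum_member : ∑ s ∈ L with p ∈ s, (-1 : ℤ) ^ #s = -signedCard (L.memberSubfamily p) := by
    have hp : ∀ s ∈ L.memberSubfamily p, p ∉ s := fun s hs => (mem_memberSubfamily.1 hs).2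
    rw [← image_insert_memberSubfamily,
      sum_image (insert_erase_invOn.2.injOn.mono fun s hs => hp s hs), signedCard,
      ← sum_neg_distrib]
    refine sum_congr rfl fun s hs => ?_
    rw [card_insert_of_notMem (hp s hs), pow_succ, mul_neg_one]
  rw [signedCard, ← sum_filter_add_sum_filter_not L (p ∈ ·), sum_member, neg_add_eq_sub]
  rfl

theorem nonMemberSubfamily_slice_subset (L : Finset (Finset α)) (p : α) (d : ℕ) :
    (L.nonMemberSubfamily p).slice d ⊆ L.slice d :=
  filter_subset_filter _ (filter_subset _ _)

theorem memberSubfamily_erase_empty (L : Finset (Finset α)) (p : α) :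
    (L.erase ∅).memberSubfamily p = L.memberSubfamily p := by
  ext s
  simp only [mem_memberSubfamily, mem_erase, ne_eq, insert_ne_empty, not_false_eq_true, true_and]

theorem insert_mem_slice {L : Finset (Finset α)} {p : α} {d : ℕ} {s : Finset α}
    (hs : s ∈ (L.memberSubfamily p).slice d) : insert p s ∈ L.slice (d + 1) := by
  rw [← memberSubfamily_slice_succ] at hs
  exact (mem_memberSubfamily.1 hs).1

theorem boundaryRank_add_boundaryRank_le (L : Finset (Finset α)) (p : α) (d : ℕ) :
    boundaryRank (L.nonMemberSubfamily p) (d + 1) + boundaryRank (L.memberSubfamily p) d ≤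
      boundaryRank L (d + 1) := by
  let avoiding (d : ℕ) : (L.nonMemberSubfamily p).slice d → L.slice d :=
    Subtype.map id fun _ hs => nonMemberSubfamily_slice_subset L p d hs
  let containing (d : ℕ) : (L.memberSubfamily p).slice d → L.slice (d + 1) :=
    Subtype.map (insert p) fun _ => insert_mem_slice
  have deletion_eq (d : ℕ) : boundaryMatrix (L.nonMemberSubfamily p) d =
      (boundaryMatrix L d).submatrix (avoiding d) (avoiding (d + 1)) := rfl
  cases d with
  | zero =>
    simpa only [boundaryRank, deletion_eq, add_zero] using
      (boundaryMatrix L 0).rank_submatrix_le (avoiding 0) (avoiding 1)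
  | succ d =>
    have link_eq : boundaryMatrix (L.memberSubfamily p) d =
        (boundaryMatrix L (d + 1)).submatrix (containing d) (containing (d + 1)) := by
      ext s t
      have hs : p ∉ s.1 := (mem_memberSubfamily.1 (mem_slice.1 s.2).1).2
      simp only [boundaryMatrix, Matrix.of_apply, Matrix.submatrix_apply, containing,
        Subtype.map, insert_subset_insert_iff hs]
    have block_zero (s : (L.memberSubfamily p).slice d)
        (t : (L.nonMemberSubfamily p).slice (d + 2)) :
        boundaryMatrix L (d + 1) (containing d s) (avoiding (d + 2) t) = 0 := by
      have ht : p ∉ t.1 := (mem_nonMemberSubfamily.1 (mem_slice.1 t.2).1).2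
      exact if_neg fun hst => ht (hst (mem_insert_self p s.1))
    rw [boundaryRank, boundaryRank, deletion_eq, link_eq]
    exact rank_submatrix_add_rank_submatrix_le _ _ _ _ _ block_zero

theorem reducedBetti_zero_le (L : Finset (Finset α)) (p : α) :
    reducedBetti L 0 ≤ reducedBetti (L.nonMemberSubfamily p) 0 := by
  have h := boundaryRank_add_boundaryRank_le L p 0
  simp only [reducedBetti, boundaryRank, card_slice_zero L p] at h ⊢
  omega

theorem reducedBetti_succ_le (L : Finset (Finset α)) (p : α) (d : ℕ) :
    reducedBetti L (d + 1) ≤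
      reducedBetti (L.nonMemberSubfamily p) (d + 1) + reducedBetti (L.memberSubfamily p) d := by
  have h₁ := boundaryRank_add_boundaryRank_le L p d
  have h₂ := boundaryRank_add_boundaryRank_le L p (d + 1)
  simp only [reducedBetti, card_slice_succ L p]
  omega

theorem card_slice_le_boundaryRank {L : Finset (Finset α)} {q : α}
    (hL : L.memberSubfamily q = L.nonMemberSubfamily q) (d : ℕ) :
    #((L.nonMemberSubfamily q).slice d) ≤ boundaryRank L (d + 1) := by
  let base : (L.nonMemberSubfamily q).slice d → L.slice d :=
    Subtype.map id fun _ hs => nonMemberSubfamily_slice_subset L q d hs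
  let coned : (L.nonMemberSubfamily q).slice d → L.slice (d + 1) :=
    Subtype.map (insert q) fun _ hs => insert_mem_slice (hL ▸ hs)
  have submatrix_eq_one : (boundaryMatrix L d).submatrix base coned = 1 := by
    ext s t
    have hs : q ∉ s.1 := (mem_nonMemberSubfamily.1 (mem_slice.1 s.2).1).2
    have card_eq : #t.1 = #s.1 := (mem_slice.1 t.2).2.trans (mem_slice.1 s.2).2.symm
    have subset_iff : s.1 ⊆ insert q t.1 ↔ s = t := by
      rw [subset_insert_iff_of_notMem hs, subset_iff_eq_of_card_le card_eq.le, Subtype.ext_iff]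
    simp only [boundaryMatrix, Matrix.submatrix_apply, Matrix.of_apply, base, coned, Subtype.map,
      id, subset_iff, Matrix.one_apply]
  have h := (boundaryMatrix L d).rank_submatrix_le base coned
  rwa [submatrix_eq_one, Matrix.rank_one, Fintype.card_coe] at h

/-- The weak Morse inequalities and the Euler characteristic of a cell complex with one cell of
dimension `k - 1` for each `k ∈ c`; as in `reducedBetti`, degrees are shifted so that the empty
face counts as a cell of degree `0`. Thus `MorseInequalities L 0` says that `L` is acyclic, and
`MorseInequalities L {k}` that `L` looks like a sphere of dimension `k - 1`. -/
structure MorseInequalities (L : Finset (Finset α)) (c : Multiset ℕ) : Prop where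
  reducedBetti_le (d : ℕ) : reducedBetti L d ≤ c.count d
  signedCard_eq : signedCard L = (c.map ((-1) ^ ·)).sum

namespace MorseInequalities

theorem map_card (L : Finset (Finset α)) : MorseInequalities L (L.val.map card) where
  reducedBetti_le d := by
    have count_eq : (L.val.map card).count d = #(L.slice d) := by
      simp only [Multiset.count_map, eq_comm (a := d)]
      rfl
    rw [count_eq, reducedBetti]
    omega
  signedCard_eq := by
    rw [Multiset.map_map]
    rfl

theorem of_memberSubfamily {L : Finset (Finset α)} {p : α} {a b : Multiset ℕ}
    (ha : MorseInequalities (L.nonMemberSubfamily p) a)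
    (hb : MorseInequalities (L.memberSubfamily p) b) :
    MorseInequalities L (a + b.map (· + 1)) where
  reducedBetti_le
    | 0 => by
      have h := (reducedBetti_zero_le L p).trans (ha.reducedBetti_le 0)
      rw [Multiset.count_add]
      omega
    | d + 1 => by
      rw [Multiset.count_add, Multiset.count_map_eq_count' _ _ (add_left_injective 1)]
      exact_mod_cast (reducedBetti_succ_le L p d).trans
        (add_le_add (ha.reducedBetti_le (d + 1)) (hb.reducedBetti_le d))
  signedCard_eq := by
    have shift : (b.map fun k => (-1 : ℤ) ^ (k + 1)).sum = -(b.map ((-1) ^ ·)).sum := by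
      simp only [pow_succ, mul_neg_one, Multiset.sum_map_neg]
    rw [signedCard_eq_sub L p, ha.signedCard_eq, hb.signedCard_eq, Multiset.map_add,
      Multiset.sum_add, Multiset.map_map, sub_eq_add_neg, ← shift]
    rfl

theorem of_cone {L : Finset (Finset α)} {q : α}
    (hL : L.memberSubfamily q = L.nonMemberSubfamily q) : MorseInequalities L 0 where
  reducedBetti_le
    | 0 => by
      have h := card_slice_le_boundaryRank hL 0
      simp only [reducedBetti, card_slice_zero L q, Multiset.count_zero]
      omega
    | d + 1 => by
      have h₁ := card_slice_le_boundaryRank hL d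
      have h₂ := card_slice_le_boundaryRank hL (d + 1)
      simp only [reducedBetti, card_slice_succ L q, hL, Multiset.count_zero]
      omega
  signedCard_eq := by
    rw [signedCard_eq_sub L q, hL, sub_self, Multiset.map_zero, Multiset.sum_zero]

end MorseInequalities

end Families

section OrderComplex

variable {α : Type*}

open Classical in
/-- The chains of `Q`, i.e. the simplices of its order complex together with the empty face. -/
noncomputable def orderComplex [LE α] (Q : Finset α) : Finset (Finset α) :=
  {s ∈ Q.powerset | IsChain (· ≤ ·) (s : Set α)}

theorem mem_orderComplex [LE α] {Q s : Finset α} :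
    s ∈ orderComplex Q ↔ s ⊆ Q ∧ IsChain (· ≤ ·) (s : Set α) := by
  simp only [orderComplex, mem_filter, mem_powerset]

theorem orderComplex_orderDual [LE α] (Q : Finset α) :
    orderComplex (α := αᵒᵈ) Q = orderComplex Q := by
  classical exact filter_congr fun _ _ => ⟨IsChain.symm, IsChain.symm⟩

theorem orderComplex_empty [LE α] : orderComplex (∅ : Finset α) = {∅} := by
  ext s
  simp only [mem_orderComplex, subset_empty, mem_singleton]
  exact ⟨And.left, fun hs => ⟨hs, by simp [hs]⟩⟩

variable [PartialOrder α] [DecidableEq α]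

theorem nonMemberSubfamily_orderComplex (Q : Finset α) (p : α) :
    (orderComplex Q).nonMemberSubfamily p = orderComplex (Q.erase p) := by
  ext s
  simp only [mem_nonMemberSubfamily, mem_orderComplex, subset_erase, and_right_comm]

theorem memberSubfamily_orderComplex {Q R : Finset α} {p : α} (hp : p ∈ Q)
    (hR : ∀ x, x ∈ R ↔ x ∈ Q ∧ x ≠ p ∧ (x ≤ p ∨ p ≤ x)) :
    (orderComplex Q).memberSubfamily p = orderComplex R := by
  ext s
  simp only [mem_memberSubfamily, mem_orderComplex, coe_insert, insert_subset_iff, hp, true_and]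
  constructor
  · rintro ⟨⟨hsQ, hchain⟩, hps⟩
    refine ⟨fun x hx => (hR x).2 ⟨hsQ hx, ne_of_mem_of_not_mem hx hps, ?_⟩,
      hchain.mono (Set.subset_insert p _)⟩
    exact hchain.total (Set.mem_insert_of_mem p hx) (Set.mem_insert p _)
  · rintro ⟨hsR, hchain⟩
    refine ⟨⟨fun x hx => ((hR x).1 (hsR hx)).1, hchain.insert fun x hx _ => ?_⟩,
      fun hps => ((hR p).1 (hsR hps)).2.1 rfl⟩
    exact ((hR x).1 (hsR hx)).2.2.symm

theorem memberSubfamily_orderComplex_of_not_lt [DecidableLT α] {Q : Finset α} {p : α} (hp : p ∈ Q)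
    (hmax : ∀ x ∈ Q, ¬p < x) :
    (orderComplex Q).memberSubfamily p = orderComplex {x ∈ Q | x < p} := by
  refine memberSubfamily_orderComplex hp fun x => ?_
  rw [mem_filter]
  refine and_congr_right fun hx => ⟨fun hxp => ⟨hxp.ne, Or.inl hxp.le⟩, ?_⟩
  rintro ⟨hne, hxp | hpx⟩
  · exact hxp.lt_of_ne hne
  · exact absurd (hpx.lt_of_ne hne.symm) (hmax x hx)

namespace MorseInequalities

theorem orderComplex_of_comparable {Q : Finset α} {q : α} (hq : q ∈ Q)
    (hcomp : ∀ x ∈ Q, x ≤ q ∨ q ≤ x) : MorseInequalities (orderComplex Q) 0 := by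
  refine of_cone (q := q) ?_
  rw [nonMemberSubfamily_orderComplex]
  refine memberSubfamily_orderComplex hq fun x => ?_
  rw [mem_erase]
  exact ⟨fun hx => ⟨hx.2, hx.1, hcomp x hx.2⟩, fun hx => ⟨hx.2.1, hx.1⟩⟩

theorem orderComplex_of_erase {Q : Finset α} {p q : α} {c : Multiset ℕ} (hp : p ∈ Q) (hq : q ∈ Q)
    (hqp : q ≠ p) (hcomp : q ≤ p ∨ p ≤ q)
    (hdom : ∀ x ∈ Q, x ≤ p ∨ p ≤ x → x ≤ q ∨ q ≤ x)
    (h : MorseInequalities (orderComplex (Q.erase p)) c) :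
    MorseInequalities (orderComplex Q) c := by
  classical
  let R : Finset α := {x ∈ Q | x ≠ p ∧ (x ≤ p ∨ p ≤ x)}
  have link_acyclic : MorseInequalities (orderComplex R) 0 :=
    orderComplex_of_comparable (mem_filter.2 ⟨hq, hqp, hcomp⟩) fun x hx =>
      hdom x (mem_filter.1 hx).1 (mem_filter.1 hx).2.2
  rw [← nonMemberSubfamily_orderComplex] at h
  rw [← memberSubfamily_orderComplex hp fun x => mem_filter] at link_acyclic
  simpa using h.of_memberSubfamily link_acyclic

theorem orderComplex_of_closure {Q : Finset α} {f : α → α} {c : Multiset ℕ}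
    (hmaps : ∀ x ∈ Q, f x ∈ Q) (hidem : ∀ x ∈ Q, f (f x) = f x) (hmono : MonotoneOn f Q)
    (hle : ∀ x ∈ Q, x ≤ f x) (h : MorseInequalities (orderComplex {x ∈ Q | f x = x}) c) :
    MorseInequalities (orderComplex Q) c := by
  induction Q using Finset.strongInduction with
  | H Q ih =>
  obtain hfix | hmoved := ({x ∈ Q | f x ≠ x} : Finset α).eq_empty_or_nonempty
  · rwa [filter_true_of_mem] at h
    simpa [filter_eq_empty_iff] using hfix
  obtain ⟨p, hp, hmax⟩ := exists_maximal hmoved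
  obtain ⟨hpQ, hfp⟩ := mem_filter.1 hp
  have fixed_of_lt : ∀ x ∈ Q, p < x → f x = x := fun x hx hpx =>
    by_contra fun hfx => hpx.not_ge (hmax (mem_filter.2 ⟨hx, hfx⟩) hpx.le)
  have dom : ∀ x ∈ Q, x ≤ p ∨ p ≤ x → x ≤ f p ∨ f p ≤ x := by
    rintro x hx (hxp | hpx)
    · exact Or.inl (hxp.trans (hle p hpQ))
    obtain rfl | hlt := hpx.eq_or_lt
    · exact Or.inl (hle p hpQ)
    · exact Or.inr (fixed_of_lt x hx hlt ▸ hmono hpQ hx hpx)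
  have maps_erase : ∀ x ∈ Q.erase p, f x ∈ Q.erase p := fun x hx =>
    mem_erase.2 ⟨fun hfx => hfp (hfx ▸ hidem x (mem_of_mem_erase hx)),
      hmaps x (mem_of_mem_erase hx)⟩
  have fixed_erase : ({x ∈ Q.erase p | f x = x} : Finset α) = {x ∈ Q | f x = x} := by
    rw [filter_erase, erase_eq_of_notMem]
    exact fun hp => hfp (mem_filter.1 hp).2
  refine orderComplex_of_erase hpQ (hmaps p hpQ) hfp (Or.inr (hle p hpQ)) dom ?_
  refine ih _ (erase_ssubset hpQ) maps_erase (fun x hx => hidem x (mem_of_mem_erase hx))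
    (hmono.mono (erase_subset p Q)) (fun x hx => hle x (mem_of_mem_erase hx)) ?_
  rwa [fixed_erase]

theorem orderComplex_of_kernel {Q : Finset α} {f : α → α} {c : Multiset ℕ}
    (hmaps : ∀ x ∈ Q, f x ∈ Q) (hidem : ∀ x ∈ Q, f (f x) = f x) (hmono : MonotoneOn f Q)
    (hle : ∀ x ∈ Q, f x ≤ x) (h : MorseInequalities (orderComplex {x ∈ Q | f x = x}) c) :
    MorseInequalities (orderComplex Q) c := by
  rw [← orderComplex_orderDual] at h ⊢
  exact orderComplex_of_closure (α := αᵒᵈ) hmaps hidem hmono.dual hle h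

theorem orderComplex_erase_empty [DecidableLT α] {Q : Finset α} (dim : α → ℕ)
    (h : ∀ p ∈ Q, MorseInequalities (orderComplex {x ∈ Q | x < p}) {dim p}) :
    MorseInequalities ((orderComplex Q).erase ∅) (Q.val.map (dim · + 1)) := by
  induction Q using Finset.strongInduction with
  | H Q ih =>
  obtain rfl | hQ := Q.eq_empty_or_nonempty
  · simpa [orderComplex_empty] using map_card (∅ : Finset (Finset α))
  obtain ⟨p, hp, hmax⟩ := exists_maximal hQ
  have not_lt : ∀ x ∈ Q, ¬p < x := fun x hx hpx => hpx.not_ge (hmax hx hpx.le)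
  have below_eq : ∀ x ∈ Q, ({y ∈ Q.erase p | y < x} : Finset α) = {y ∈ Q | y < x} :=
    fun x hx => by
      rw [filter_erase, erase_eq_of_notMem]
      exact fun hp => not_lt x hx (mem_filter.1 hp).2
  have deletion : MorseInequalities (((orderComplex Q).erase ∅).nonMemberSubfamily p)
      ((Q.erase p).val.map (dim · + 1)) := by
    rw [nonMemberSubfamily, filter_erase, ← nonMemberSubfamily, nonMemberSubfamily_orderComplex]
    refine ih _ (erase_ssubset hp) fun x hx => ?_
    rw [below_eq x (mem_of_mem_erase hx)]
    exact h x (mem_of_mem_erase hx)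
  have link : MorseInequalities (((orderComplex Q).erase ∅).memberSubfamily p) {dim p} := by
    rw [memberSubfamily_erase_empty, memberSubfamily_orderComplex_of_not_lt hp not_lt]
    exact h p hp
  have cells_eq : Q.val.map (dim · + 1) =
      (Q.erase p).val.map (dim · + 1) + ({dim p} : Multiset ℕ).map (· + 1) := by
    conv_lhs => rw [← insert_erase hp, insert_val_of_notMem (notMem_erase p Q)]
    rw [Multiset.map_cons, Multiset.map_singleton, ← Multiset.singleton_add, add_comm]
  rw [cells_eq]
  exact of_memberSubfamily deletion link

end MorseInequalities

end OrderComplex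

section Nonconstant

variable {ι β : Type*} {e : ι → β} {σ ρ : Finset ι}

/-- `e` takes at least two values on `σ`. -/
def IsNonconstantOn (e : ι → β) (σ : Finset ι) : Prop :=
  ∃ v ∈ σ, ∃ w ∈ σ, e v ≠ e w

instance [DecidableEq β] (e : ι → β) : DecidablePred (IsNonconstantOn e) :=
  fun σ => inferInstanceAs (Decidable (∃ v ∈ σ, ∃ w ∈ σ, e v ≠ e w))

namespace IsNonconstantOn

theorem mono (hρ : IsNonconstantOn e ρ) (h : ρ ⊆ σ) : IsNonconstantOn e σ := by
  obtain ⟨v, hv, w, hw, hvw⟩ := hρ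
  exact ⟨v, h hv, w, h hw, hvw⟩

theorem exists_ne (hσ : IsNonconstantOn e σ) (b : β) : ∃ w ∈ σ, e w ≠ b := by
  obtain ⟨v, hv, w, hw, hvw⟩ := hσ
  obtain hvb | rfl := ne_or_eq (e v) b
  · exact ⟨v, hv, hvb⟩
  · exact ⟨w, hw, hvw.symm⟩

theorem two_le_card (hσ : IsNonconstantOn e σ) : 2 ≤ #σ := by
  obtain ⟨v, hv, w, hw, hvw⟩ := hσ
  exact one_lt_card.2 ⟨v, hv, w, hw, fun h => hvw (congrArg e h)⟩

theorem erase [DecidableEq ι] {v w : ι} (hσ : IsNonconstantOn e σ) (hw : w ∈ σ) (hwv : w ≠ v)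
    (h : e w = e v) : IsNonconstantOn e (σ.erase v) := by
  obtain ⟨u, hu, huv⟩ := hσ.exists_ne (e v)
  exact ⟨w, mem_erase.2 ⟨hwv, hw⟩, u, mem_erase.2 ⟨fun huv' => huv (huv' ▸ rfl), hu⟩,
    h ▸ huv.symm⟩

end IsNonconstantOn

variable [DecidableEq ι] [DecidableEq β]

/-- The subset of `insert v ρ` from which all elements with the same value as `v`, except `v`
itself, have been removed. -/
def isolate (e : ι → β) (v : ι) (ρ : Finset ι) : Finset ι :=
  insert v {w ∈ ρ | e w ≠ e v}

theorem isolate_subset {v : ι} (hv : v ∈ ρ) : isolate e v ρ ⊆ ρ :=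
  insert_subset hv (filter_subset _ ρ)

theorem isolate_mono (e : ι → β) (v : ι) : Monotone (isolate e v) := fun _ _ h =>
  insert_subset_insert v (filter_subset_filter _ h)

theorem isolate_idem (e : ι → β) (v : ι) (ρ : Finset ι) :
    isolate e v (isolate e v ρ) = isolate e v ρ := by
  have filter_isolate : ({w ∈ isolate e v ρ | e w ≠ e v} : Finset ι) = {w ∈ ρ | e w ≠ e v} := by
    rw [isolate, filter_insert, if_neg (not_ne_iff.2 rfl), filter_filter]
    simp only [and_self]
  rw [isolate, filter_isolate, isolate]

theorem IsNonconstantOn.isolate {v : ι} (hρ : IsNonconstantOn e ρ) :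
    IsNonconstantOn e (isolate e v ρ) := by
  obtain ⟨w, hw, hwv⟩ := hρ.exists_ne (e v)
  exact ⟨v, mem_insert_self v _, w, mem_insert_of_mem (mem_filter.2 ⟨hw, hwv⟩), hwv.symm⟩

/-- The proper subsets of `σ` on which `e` is not constant. -/
def nonconstantSSubsets (e : ι → β) (σ : Finset ι) : Finset (Finset ι) :=
  {ρ ∈ σ.ssubsets | IsNonconstantOn e ρ}

theorem mem_nonconstantSSubsets : ρ ∈ nonconstantSSubsets e σ ↔ ρ ⊂ σ ∧ IsNonconstantOn e ρ := by
  rw [nonconstantSSubsets, mem_filter, mem_ssubsets]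

theorem nonconstantSSubsets_eq_empty (hσ : #σ ≤ 2) : nonconstantSSubsets e σ = ∅ := by
  refine eq_empty_of_forall_notMem fun ρ hρ => ?_
  obtain ⟨hρσ, hρ⟩ := mem_nonconstantSSubsets.1 hρ
  exact ((card_lt_card hρσ).trans_le hσ).not_ge hρ.two_le_card

theorem filter_lt_nonconstantSSubsets (h : ρ ⊂ σ) :
    {τ ∈ nonconstantSSubsets e σ | τ < ρ} = nonconstantSSubsets e ρ := by
  ext τ
  simp only [mem_filter, mem_nonconstantSSubsets]
  exact ⟨fun hτ => ⟨hτ.2, hτ.1.2⟩, fun hτ => ⟨⟨hτ.1.trans h, hτ.2⟩, hτ.1⟩⟩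

namespace MorseInequalities

theorem orderComplex_nonconstantSSubsets_mem {v w : ι} (hσ : IsNonconstantOn e σ) (hv : v ∈ σ)
    (hw : w ∈ σ) (hwv : w ≠ v) (h : e w = e v) :
    MorseInequalities (orderComplex {ρ ∈ nonconstantSSubsets e σ | v ∈ ρ}) 0 := by
  have mem_iff (ρ : Finset ι) : ρ ∈ {ρ ∈ nonconstantSSubsets e σ | v ∈ ρ} ↔
      ρ ⊂ σ ∧ IsNonconstantOn e ρ ∧ v ∈ ρ := by
    rw [mem_filter, mem_nonconstantSSubsets, and_assoc]
  have apex_ssubset : isolate e v σ ⊂ σ := by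
    refine LE.le.trans_ssubset ?_ (erase_ssubset hw)
    refine subset_erase.2 ⟨isolate_subset hv, fun hw' => ?_⟩
    obtain hwv' | hw' := mem_insert.1 hw'
    · exact hwv hwv'
    · exact (mem_filter.1 hw').2 h
  refine orderComplex_of_kernel (f := isolate e v) (fun ρ hρ => ?_)
    (fun ρ _ => isolate_idem e v ρ) ((isolate_mono e v).monotoneOn _)
    (fun ρ hρ => isolate_subset (mem_filter.1 hρ).2) ?_
  · obtain ⟨hρσ, hρ, hvρ⟩ := (mem_iff ρ).1 hρ
    exact (mem_iff _).2 ⟨(isolate_subset hvρ).trans_ssubset hρσ, hρ.isolate,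
      mem_insert_self v _⟩
  · refine orderComplex_of_comparable (q := isolate e v σ) (mem_filter.2 ⟨(mem_iff _).2
      ⟨apex_ssubset, hσ.isolate, mem_insert_self v _⟩, isolate_idem e v σ⟩) fun ρ hρ => ?_
    obtain ⟨hρ, hfixed⟩ := mem_filter.1 hρ
    exact Or.inl (hfixed ▸ isolate_mono e v ((mem_iff ρ).1 hρ).1.subset)

theorem orderComplex_nonconstantSSubsets_erase {v w : ι} (hσ : IsNonconstantOn e σ) (hv : v ∈ σ)
    (hw : w ∈ σ) (hwv : w ≠ v) (h : e w = e v) :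
    MorseInequalities (orderComplex ((nonconstantSSubsets e σ).erase (σ.erase v))) 0 := by
  have mem_iff (ρ : Finset ι) : ρ ∈ (nonconstantSSubsets e σ).erase (σ.erase v) ↔
      ρ ≠ σ.erase v ∧ ρ ⊂ σ ∧ IsNonconstantOn e ρ := by
    rw [mem_erase, mem_nonconstantSSubsets]
  have insert_ne {ρ : Finset ι} (hρv : ρ ≠ σ.erase v) (hρσ : ρ ⊂ σ) : insert v ρ ≠ σ := by
    rintro rfl
    by_cases hvρ : v ∈ ρ
    · exact hρσ.ne (insert_eq_of_mem hvρ).symm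
    · exact hρv (erase_insert hvρ).symm
  have fixed_eq : ({ρ ∈ (nonconstantSSubsets e σ).erase (σ.erase v) | insert v ρ = ρ} :
      Finset (Finset ι)) = {ρ ∈ nonconstantSSubsets e σ | v ∈ ρ} := by
    rw [filter_erase, erase_eq_of_notMem]
    · simp only [insert_eq_self]
    · exact fun hmem => notMem_erase v σ (insert_eq_self.1 (mem_filter.1 hmem).2)
  refine orderComplex_of_closure (f := insert v) (fun ρ hρ => ?_)
    (fun ρ _ => insert_idem v ρ) (fun _ _ _ _ hle => insert_subset_insert v hle)
    (fun ρ _ => subset_insert v ρ) (fixed_eq ▸ orderComplex_nonconstantSSubsets_mem hσ hv hw hwv h)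
  obtain ⟨hρv, hρσ, hρ⟩ := (mem_iff ρ).1 hρ
  exact (mem_iff _).2 ⟨fun heq => notMem_erase v σ (heq ▸ mem_insert_self v ρ),
    (insert_subset hv hρσ.subset).ssubset_of_ne (insert_ne hρv hρσ),
    hρ.mono (subset_insert v ρ)⟩

theorem orderComplex_nonconstantSSubsets [Fintype β] (hβ : Fintype.card β ≤ 2)
    (hσ : IsNonconstantOn e σ) :
    MorseInequalities (orderComplex (nonconstantSSubsets e σ)) {#σ - 2} := by
  induction σ using Finset.strongInduction with
  | H σ ih =>
  obtain card_eq | two_lt := hσ.two_le_card.eq_or_lt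
  · rw [nonconstantSSubsets_eq_empty card_eq.ge, orderComplex_empty, ← card_eq]
    exact map_card {∅}
  obtain ⟨v, hv, w, hw, hvw, h⟩ := exists_ne_map_eq_of_card_lt_of_maps_to
    (hβ.trans_lt two_lt) (f := e) (t := univ) fun _ _ => mem_univ _
  have erase_nonconstant : IsNonconstantOn e (σ.erase v) := hσ.erase hw hvw.symm h.symm
  have maximal : ∀ ρ ∈ nonconstantSSubsets e σ, ¬σ.erase v < ρ := by
    intro ρ hρ hlt
    have := card_lt_card (mem_nonconstantSSubsets.1 hρ).1
    have := card_lt_card hlt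
    rw [card_erase_of_mem hv] at this
    omega
  have deletion := orderComplex_nonconstantSSubsets_erase hσ hv hw hvw.symm h.symm
  have link := ih _ (erase_ssubset hv) erase_nonconstant
  rw [← nonMemberSubfamily_orderComplex] at deletion
  rw [← filter_lt_nonconstantSSubsets (erase_ssubset hv),
    ← memberSubfamily_orderComplex_of_not_lt
      (mem_nonconstantSSubsets.2 ⟨erase_ssubset hv, erase_nonconstant⟩) maximal,
    card_erase_of_mem hv] at link
  have cells_eq : ({#σ - 2} : Multiset ℕ) = 0 + ({#σ - 1 - 2} : Multiset ℕ).map (· + 1) := by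
    rw [zero_add, Multiset.map_singleton]
    congr 1
    omega
  rw [cells_eq]
  exact of_memberSubfamily deletion link

end MorseInequalities

end Nonconstant

theorem MorseInequalities.orderComplex_nonconstant {ι β : Type*} [DecidableEq ι] [Fintype β]
    (hβ : Fintype.card β ≤ 2) {e : ι → β} {Q : Finset (Finset ι)}
    (hQ : ∀ σ ∈ Q, IsNonconstantOn e σ)
    (hsub : ∀ σ ∈ Q, ∀ ρ ⊆ σ, IsNonconstantOn e ρ → ρ ∈ Q) :
    MorseInequalities ((orderComplex Q).erase ∅) (Q.val.map (#· - 1)) := by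
  classical
  have below_eq : ∀ σ ∈ Q, {ρ ∈ Q | ρ < σ} = nonconstantSSubsets e σ := by
    intro σ hσ
    ext ρ
    rw [mem_filter, mem_nonconstantSSubsets]
    exact ⟨fun hρ => ⟨hρ.2, hQ ρ hρ.1⟩, fun hρ => ⟨hsub σ hσ ρ hρ.1.subset hρ.2, hρ.1⟩⟩
  have degree_eq : Q.val.map (#· - 1) = Q.val.map (#· - 2 + 1) :=
    Multiset.map_congr rfl fun σ hσ => by
      have := (hQ σ hσ).two_le_card
      omega
  rw [degree_eq]
  refine orderComplex_erase_empty (#· - 2) fun σ hσ => ?_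
  rw [below_eq σ hσ]
  exact orderComplex_nonconstantSSubsets hβ (hQ σ hσ)

section Homology

variable {ι : Type*} {K : PreAbstractSimplicialComplex ι}

theorem Simplex.facet_val [DecidableEq ι] {p : ℕ} (τ : Simplex K (p + 1)) (v : {v // v ∈ τ.1}) :
    (τ.facet v).1 = τ.1.erase v.1 := by
  simp only [Simplex.facet]
  congr!

theorem boundary_single {p : ℕ} (τ : Simplex K (p + 1)) :
    boundary K p (Finsupp.single τ 1) =
      ∑ v ∈ τ.1.attach, Finsupp.single (τ.facet v) (1 : ZMod 2) := by
  simp [boundary]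

theorem boundary_single_apply [DecidableEq ι] {p : ℕ} (τ : Simplex K (p + 1)) (s : Simplex K p) :
    boundary K p (Finsupp.single τ 1) s = if s.1 ⊆ τ.1 then 1 else 0 := by
  classical
  simp only [boundary_single, Finsupp.finsetSum_apply, Finsupp.single_apply]
  split_ifs with h
  · obtain ⟨v, hv⟩ : ∃ v, τ.1 \ s.1 = {v} := by
      rw [← card_eq_one, card_sdiff_of_subset h, τ.2.2, s.2.2]
      omega
    have mem_iff (w : ι) : w ∈ τ.1 ∧ w ∉ s.1 ↔ w = v := by
      rw [← mem_sdiff, hv, mem_singleton]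
    rw [sum_eq_single ⟨v, ((mem_iff v).2 rfl).1⟩]
    · refine if_pos (Subtype.ext ?_)
      rw [Simplex.facet_val, erase_eq, ← hv, Finset.sdiff_sdiff_eq_self h]
    · intro w _ hw
      refine if_neg fun hs => hw (Subtype.ext ((mem_iff w).1 ⟨w.2, ?_⟩))
      rw [← hs, Simplex.facet_val]
      exact notMem_erase w.1 τ.1
    · exact fun hn => absurd (mem_attach _ _) hn
  · refine sum_eq_zero fun v _ => if_neg fun hs => h ?_
    rw [← hs, Simplex.facet_val]
    exact erase_subset _ _

theorem boundary_boundary (p : ℕ) (z : Chain K (p + 2)) :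
    boundary K p (boundary K (p + 1) z) = 0 := by
  classical
  suffices h : boundary K p ∘ₗ boundary K (p + 1) = 0 from LinearMap.congr_fun h z
  refine Finsupp.lhom_ext' fun τ => LinearMap.ext_ring ?_
  change boundary K p (boundary K (p + 1) (Finsupp.single τ 1)) = 0
  rw [boundary_single, map_sum]
  simp only [boundary_single]
  rw [sum_sigma']
  have mem_of_facet (x : (v : {v // v ∈ τ.1}) × {w // w ∈ (τ.facet v).1}) :
      x.2.1 ≠ x.1.1 ∧ x.2.1 ∈ τ.1 := mem_erase.1 (Simplex.facet_val τ x.1 ▸ x.2.2)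
  have add_self (s : Simplex K p) : Finsupp.single s (1 : ZMod 2) + Finsupp.single s 1 = 0 := by
    rw [← Finsupp.single_add, CharTwo.add_self_eq_zero, Finsupp.single_zero]
  refine sum_involution (fun x _ => ⟨⟨x.2.1, (mem_of_facet x).2⟩, ⟨x.1.1, ?_⟩⟩)
    (fun x _ => ?_) (fun x _ _ h => ?_) (fun _ _ => mem_sigma.2 ⟨mem_attach _ _, mem_attach _ _⟩)
    fun _ _ => rfl
  · rw [Simplex.facet_val]
    exact mem_erase.2 ⟨(mem_of_facet x).1.symm, x.1.2⟩
  · convert add_self _ using 3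
    refine Subtype.ext ?_
    simp only [Simplex.facet_val]
    exact erase_right_comm
  · exact (mem_of_facet x).1 (congrArg (fun y => y.1.1) h)

theorem boundaries_le_cycles (p : ℕ) : boundaries K p ≤ cycles K p := by
  cases p with
  | zero => exact le_top
  | succ p =>
    rintro _ ⟨z, rfl⟩
    exact boundary_boundary p z

variable {F : Finset (Finset ι)}

/-- The `p`-simplices of `K` as the members of its family of faces with `p + 1` elements. -/
def simplexEquiv (hF : ∀ s, s ∈ F ↔ s ∈ K.faces) (p : ℕ) : Simplex K p ≃ F.slice (p + 1) :=
  Equiv.subtypeEquivRight fun s => by rw [mem_slice, hF]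

theorem faceNumber_eq (hF : ∀ s, s ∈ F ↔ s ∈ K.faces) (p : ℕ) :
    faceNumber K p = #(F.slice (p + 1)) := by
  rw [faceNumber, Nat.card_congr (simplexEquiv hF p), Nat.card_eq_fintype_card, Fintype.card_coe]

theorem slice_zero_eq_empty (hF : ∀ s, s ∈ F ↔ s ∈ K.faces) : F.slice 0 = ∅ := by
  refine eq_empty_of_forall_notMem fun s hs => ?_
  obtain ⟨hsF, hs₀⟩ := mem_slice.1 hs
  exact (K.isRelLowerSet_faces ((hF s).1 hsF)).1.ne_empty (card_eq_zero.1 hs₀)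

variable [DecidableEq ι]

theorem boundaryRank_one (hF : ∀ s, s ∈ F ↔ s ∈ K.faces) : boundaryRank F 1 = 0 := by
  have : IsEmpty (F.slice 0) := isEmpty_coe_sort.2 (slice_zero_eq_empty hF)
  exact Nat.le_zero.1 ((boundaryMatrix F 0).rank_le_card_height.trans_eq Fintype.card_eq_zero)

theorem finrank_boundaries (hF : ∀ s, s ∈ F ↔ s ∈ K.faces) (p : ℕ) :
    Module.finrank (ZMod 2) (boundaries K p) = boundaryRank F (p + 2) := by
  classical
  have (q : ℕ) : Fintype (Simplex K q) := Fintype.ofEquiv _ (simplexEquiv hF q).symm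
  have toMatrix_eq :
      LinearMap.toMatrix Finsupp.basisSingleOne Finsupp.basisSingleOne (boundary K p) =
        (boundaryMatrix F (p + 1)).submatrix (simplexEquiv hF p) (simplexEquiv hF (p + 1)) := by
    ext s t
    rw [LinearMap.toMatrix_apply, Finsupp.coe_basisSingleOne, Finsupp.basisSingleOne_repr,
      LinearEquiv.refl_apply, boundary_single_apply]
    rfl
  rw [boundaryRank, ← Matrix.rank_submatrix _ (simplexEquiv hF p) (simplexEquiv hF (p + 1)),
    ← toMatrix_eq, Matrix.rank_eq_finrank_range_toLin _ Finsupp.basisSingleOne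
      Finsupp.basisSingleOne, Matrix.toLin_toMatrix]
  rfl

theorem finrank_cycles (hF : ∀ s, s ∈ F ↔ s ∈ K.faces) (p : ℕ) :
    Module.finrank (ZMod 2) (cycles K p) + boundaryRank F (p + 1) = #(F.slice (p + 1)) := by
  have (q : ℕ) : Fintype (Simplex K q) := Fintype.ofEquiv _ (simplexEquiv hF q).symm
  have finrank_chain (q : ℕ) : Module.finrank (ZMod 2) (Chain K q) = #(F.slice (q + 1)) := by
    rw [Module.finrank_finsupp_self, ← Nat.card_eq_fintype_card, ← faceNumber_eq hF]
    rfl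
  cases p with
  | zero =>
    rw [boundaryRank_one hF, add_zero, ← finrank_chain]
    exact finrank_top _ _
  | succ p =>
    rw [← finrank_boundaries hF, ← finrank_chain, ← (boundary K p).finrank_range_add_finrank_ker,
      add_comm]
    rfl

theorem betti_eq_reducedBetti (hF : ∀ s, s ∈ F ↔ s ∈ K.faces) (p : ℕ) :
    (betti K p : ℤ) = reducedBetti F (p + 1) := by
  have (q : ℕ) : Finite (Simplex K q) := Finite.of_equiv _ (simplexEquiv hF q).symm
  have quotient : betti K p + _ = _ :=
    ((boundaries K p).submoduleOf (cycles K p)).finrank_quotient_add_finrank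
  rw [(Submodule.submoduleOfEquivOfLe (boundaries_le_cycles (K := K) p)).finrank_eq,
    finrank_boundaries hF] at quotient
  have := finrank_cycles hF p
  change (betti K p : ℤ) =
    #(F.slice (p + 1)) - boundaryRank F (p + 1) - boundaryRank F (p + 2)
  omega

end Homology

theorem eulerChar_eq_neg_signedCard {ι : Type*} {K : PreAbstractSimplicialComplex ι}
    {F : Finset (Finset ι)} (hF : ∀ s, s ∈ F ↔ s ∈ K.faces) : eulerChar K = -signedCard F := by
  classical
  let N := F.sup card
  have card_lt : ∀ s ∈ F, #s < N + 1 := fun s hs => Nat.lt_succ_of_le (le_sup (f := card) hs)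
  have support_subset : (Function.support fun i => (-1 : ℤ) ^ i * (betti K i : ℤ)) ⊆ range N := by
    refine fun i hi => mem_coe.2 (mem_range.2 (by_contra fun hNi => hi ?_))
    have slice_eq_empty : F.slice (i + 1) = ∅ := eq_empty_of_forall_notMem fun s hs => by
      have := card_lt s (mem_slice.1 hs).1
      have := (mem_slice.1 hs).2
      omega
    have betti_eq_zero : (betti K i : ℤ) = 0 := by
      have := betti_eq_reducedBetti hF i
      rw [reducedBetti, slice_eq_empty, card_empty] at this
      omega
    exact mul_eq_zero_of_right _ betti_eq_zero
  have reducedBetti_zero : reducedBetti F 0 = 0 := by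
    rw [reducedBetti, boundaryRank_one hF, slice_zero_eq_empty hF]
    rfl
  rw [eulerChar, finsum_eq_sum_of_support_subset _ support_subset,
    ← sum_range_reducedBetti card_lt, sum_range_succ', reducedBetti_zero, mul_zero, add_zero,
    ← sum_neg_distrib]
  refine sum_congr rfl fun i _ => ?_
  rw [betti_eq_reducedBetti hF, pow_succ, mul_neg_one, neg_mul, neg_neg]

section DualSubcomplex

variable {ι : Type*} {K : PreAbstractSimplicialComplex ι}

open Classical in
/-- The value of a `0`-cochain on a vertex, extended by zero to the elements of `ι` which are not
vertices of `K`. -/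
noncomputable def vertexValue (ε : Cochain K 0) (x : ι) : ZMod 2 :=
  if h : {x} ∈ K.faces then ε ⟨{x}, h, card_singleton x⟩ else 0

/-- The vertex `x` of a face `σ`, as a `0`-simplex of `K`. -/
def vertexOfMem {σ : Finset ι} (hσ : σ ∈ K.faces) (x : {x // x ∈ σ}) : Simplex K 0 :=
  ⟨{x.1}, (K.isRelLowerSet_faces hσ).2 (singleton_subset_iff.2 x.2) (singleton_nonempty x.1),
    card_singleton x.1⟩

theorem vertexValue_of_mem (ε : Cochain K 0) {σ : Finset ι} (hσ : σ ∈ K.faces) {x : ι}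
    (hx : x ∈ σ) : vertexValue ε x = ε (vertexOfMem hσ ⟨x, hx⟩) :=
  dif_pos (vertexOfMem hσ ⟨x, hx⟩).2.1

theorem cochain_eq_sum_vertexValue (ε : Cochain K 0) (ρ : Simplex K 0) :
    ε ρ = ∑ x ∈ ρ.1, vertexValue ε x := by
  obtain ⟨ρ, hρ, hcard⟩ := ρ
  obtain ⟨x, rfl⟩ := card_eq_one.1 hcard
  rw [sum_singleton, vertexValue_of_mem ε hρ (mem_singleton_self x), vertexOfMem]

theorem coboundary_eq_sum_vertexValue (ε : Cochain K 0) (τ : Simplex K 1) :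
    coboundary ε τ = ∑ x ∈ τ.1, vertexValue ε x := by
  classical
  obtain ⟨x, y, hxy, hτ⟩ := card_eq_two.1 τ.2.2
  have facet_value (v : {v // v ∈ τ.1}) :
      ε (τ.facet v) = ∑ u ∈ τ.1.erase v.1, vertexValue ε u := by
    rw [cochain_eq_sum_vertexValue ε (τ.facet v), Simplex.facet_val]
  rw [coboundary, sum_congr rfl fun v _ => facet_value v,
    sum_attach τ.1 fun v => ∑ u ∈ τ.1.erase v, vertexValue ε u, hτ, sum_pair hxy, sum_pair hxy,
    pair_comm, erase_insert (by simpa using hxy.symm), pair_comm,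
    erase_insert (by simpa using hxy), sum_singleton, sum_singleton, add_comm]

theorem coboundary_ne_zero_iff (ε : Cochain K 0) (τ : Simplex K 1) :
    coboundary ε τ ≠ 0 ↔ IsNonconstantOn (vertexValue ε) τ.1 := by
  classical
  obtain ⟨x, y, hxy, hτ⟩ := card_eq_two.1 τ.2.2
  rw [coboundary_eq_sum_vertexValue, hτ, sum_pair hxy, Ne, CharTwo.add_eq_zero, IsNonconstantOn]
  simp [eq_comm]

theorem exists_subset_of_isChain {α : Type*} {s : Finset (Finset α)} (hs : s.Nonempty)
    (h : IsChain (· ⊆ ·) (s : Set (Finset α))) : ∃ m ∈ s, ∀ σ ∈ s, m ⊆ σ := by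
  obtain ⟨m, hm, hmin⟩ := exists_minimal hs
  exact ⟨m, hm, fun σ hσ => (h.total hm hσ).elim id fun hσm => hmin hσ hσm⟩

theorem mem_faces_dualSubcomplex_iff (ε : Cochain K 0) (s : Finset (Finset ι)) :
    s ∈ (dualSubcomplex ε).faces ↔ s.Nonempty ∧
      (∀ σ ∈ s, σ ∈ K.faces ∧ IsNonconstantOn (vertexValue ε) σ) ∧
      IsChain (· ⊆ ·) (s : Set (Finset ι)) := by
  classical
  constructor
  · rintro ⟨hne, c, hc, hsc, σ₀, -, hmin, hd⟩
    exact ⟨hne, fun σ hσ => ⟨hc.2.1 σ (hsc hσ),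
      ((coboundary_ne_zero_iff ε σ₀).1 hd).mono (hmin σ (hsc hσ))⟩, hc.2.2.mono hsc⟩
  · rintro ⟨hne, hs, hchain⟩
    obtain ⟨m, hm, hmin⟩ := exists_subset_of_isChain hne hchain
    obtain ⟨hmK, x, hx, y, hy, hxy⟩ := hs m hm
    have pair_subset : {x, y} ⊆ m := insert_subset hx (singleton_subset_iff.2 hy)
    let edge : Simplex K 1 := ⟨{x, y},
      (K.isRelLowerSet_faces hmK).2 pair_subset (insert_nonempty x {y}),
      card_pair fun h => hxy (congrArg _ h)⟩
    refine ⟨hne, insert edge.1 s, ⟨insert_nonempty _ _, ?_, ?_⟩, subset_insert _ _, edge,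
      mem_insert_self _ _, ?_, ?_⟩
    · exact forall_mem_insert .. |>.2 ⟨edge.2.1, fun σ hσ => (hs σ hσ).1⟩
    · rw [coe_insert]
      exact hchain.insert fun σ hσ _ => Or.inl (pair_subset.trans (hmin σ hσ))
    · exact forall_mem_insert .. |>.2 ⟨subset_rfl, fun σ hσ => pair_subset.trans (hmin σ hσ)⟩
    · exact (coboundary_ne_zero_iff ε edge).2
        ⟨x, mem_insert_self x _, y, mem_insert_of_mem (mem_singleton_self y), hxy⟩

variable {F : Finset (Finset ι)}

/-- The members of `F` on which the cochain `ε` is not constant; if `F` lists the faces of `K`,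
these are the vertices of `dualSubcomplex ε`. -/
noncomputable def nonconstantFaces (F : Finset (Finset ι)) (ε : Cochain K 0) :
    Finset (Finset ι) :=
  {σ ∈ F | IsNonconstantOn (vertexValue ε) σ}

theorem mem_nonconstantFaces {ε : Cochain K 0} {σ : Finset ι} :
    σ ∈ nonconstantFaces F ε ↔ σ ∈ F ∧ IsNonconstantOn (vertexValue ε) σ :=
  mem_filter

theorem mem_orderComplex_nonconstantFaces [DecidableEq ι] (hF : ∀ s, s ∈ F ↔ s ∈ K.faces)
    (ε : Cochain K 0) (s : Finset (Finset ι)) :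
    s ∈ (orderComplex (nonconstantFaces F ε)).erase ∅ ↔ s ∈ (dualSubcomplex ε).faces := by
  rw [mem_faces_dualSubcomplex_iff, mem_erase, mem_orderComplex, nonempty_iff_ne_empty, subset_iff]
  simp only [mem_nonconstantFaces, hF]

theorem morseInequalities_nonconstantFaces [DecidableEq ι] (hF : ∀ s, s ∈ F ↔ s ∈ K.faces)
    (ε : Cochain K 0) :
    MorseInequalities ((orderComplex (nonconstantFaces F ε)).erase ∅)
      ((nonconstantFaces F ε).val.map (#· - 1)) := by
  refine .orderComplex_nonconstant (ZMod.card 2).le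
    (fun σ hσ => (mem_nonconstantFaces.1 hσ).2) fun σ hσ ρ hρσ hρ => ?_
  have hσK : σ ∈ K.faces := (hF σ).1 (mem_nonconstantFaces.1 hσ).1
  obtain ⟨x, hx, -⟩ := hρ.exists_ne 0
  exact mem_nonconstantFaces.2 ⟨(hF ρ).2 ((K.isRelLowerSet_faces hσK).2 hρσ ⟨x, hx⟩), hρ⟩

theorem betti_dualSubcomplex_le (hF : ∀ s, s ∈ F ↔ s ∈ K.faces) (ε : Cochain K 0) (i : ℕ) :
    betti (dualSubcomplex ε) i ≤ #(nonconstantFaces (F.slice (i + 2)) ε) := by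
  classical
  have h := (morseInequalities_nonconstantFaces hF ε).reducedBetti_le (i + 1)
  rw [← betti_eq_reducedBetti (mem_orderComplex_nonconstantFaces hF ε), Nat.cast_le,
    Multiset.count_map] at h
  refine h.trans (card_le_card (s := {σ ∈ nonconstantFaces F ε | i + 1 = #σ - 1}) fun σ hσ => ?_)
  obtain ⟨hσ, card_eq⟩ := mem_filter.1 hσ
  obtain ⟨hσF, hσ⟩ := mem_nonconstantFaces.1 hσ
  exact mem_nonconstantFaces.2 ⟨mem_slice.2 ⟨hσF, by omega⟩, hσ⟩

theorem eulerChar_dualSubcomplex (hF : ∀ s, s ∈ F ↔ s ∈ K.faces) (ε : Cochain K 0) :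
    eulerChar (dualSubcomplex ε) = signedCard (nonconstantFaces F ε) := by
  classical
  rw [eulerChar_eq_neg_signedCard (mem_orderComplex_nonconstantFaces hF ε),
    (morseInequalities_nonconstantFaces hF ε).signedCard_eq, Multiset.map_map, signedCard,
    neg_eq_iff_eq_neg, ← sum_neg_distrib]
  refine sum_congr rfl fun σ hσ => ?_
  have := (mem_nonconstantFaces.1 hσ).2.two_le_card
  rw [Function.comp_apply, ← Nat.sub_add_cancel (one_le_two.trans this), pow_succ, mul_neg_one,
    neg_neg, Nat.add_sub_cancel]

end DualSubcomplex

section Probability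

variable {ι : Type*} {K : PreAbstractSimplicialComplex ι} {ν : ℝ}

theorem isProbabilityMeasure_bernoulliLaw (hν : ν ∈ Set.Icc (0 : ℝ) 1) :
    IsProbabilityMeasure (bernoulliLaw ν) := by
  refine ⟨?_⟩
  simp [bernoulliLaw, ← ENNReal.ofReal_add hν.1 (sub_nonneg.2 hν.2)]

theorem bernoulliLaw_real_zero (hν : ν ∈ Set.Icc (0 : ℝ) 1) : (bernoulliLaw ν).real {0} = ν := by
  simp [bernoulliLaw, Measure.real, hν.1]

theorem bernoulliLaw_real_one (hν : ν ∈ Set.Icc (0 : ℝ) 1) :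
    (bernoulliLaw ν).real {1} = 1 - ν := by
  simp [bernoulliLaw, Measure.real, hν.2]

variable [Finite K.faces]

theorem isProbabilityMeasure_cochainLaw (p : ℕ) (hν : ν ∈ Set.Icc (0 : ℝ) 1) :
    IsProbabilityMeasure (cochainLaw K p ν) := by
  have := isProbabilityMeasure_bernoulliLaw hν
  unfold cochainLaw
  infer_instance

theorem cochainLaw_real_forall_mem_eq {p : ℕ} (hν : ν ∈ Set.Icc (0 : ℝ) 1)
    (S : Finset (Simplex K p)) (c : ZMod 2) :
    (cochainLaw K p ν).real {ε | ∀ ρ ∈ S, ε ρ = c} = (bernoulliLaw ν).real {c} ^ #S := by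
  have := isProbabilityMeasure_bernoulliLaw hν
  let : Fintype (Simplex K p) := Fintype.ofFinite _
  have set_eq : {ε : Cochain K p | ∀ ρ ∈ S, ε ρ = c} = (S : Set (Simplex K p)).pi fun _ => {c} :=
    rfl
  rw [set_eq, cochainLaw, Measure.real, Measure.pi_pi_finset, prod_const, ENNReal.toReal_pow]
  rfl

theorem cochainLaw_real_constant (hν : ν ∈ Set.Icc (0 : ℝ) 1) {σ : Finset ι} (hσ : σ ∈ K.faces)
    (c : ZMod 2) :
    (cochainLaw K 0 ν).real {ε | ∀ x ∈ σ, vertexValue ε x = c} =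
      (bernoulliLaw ν).real {c} ^ #σ := by
  let vertex : {x // x ∈ σ} ↪ Simplex K 0 := ⟨vertexOfMem hσ, fun _ _ h =>
    Subtype.ext (singleton_injective (congrArg Subtype.val h))⟩
  have set_eq : {ε : Cochain K 0 | ∀ x ∈ σ, vertexValue ε x = c} =
      {ε | ∀ ρ ∈ σ.attach.map vertex, ε ρ = c} := by
    ext ε
    simp only [Set.mem_ofPred_eq, forall_mem_map, mem_attach, true_imp_iff, Subtype.forall]
    exact forall₂_congr fun x hx => by rw [vertexValue_of_mem ε hσ hx]; rfl
  rw [set_eq, cochainLaw_real_forall_mem_eq hν, card_map, card_attach]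

theorem cochainLaw_real_nonconstant (hν : ν ∈ Set.Icc (0 : ℝ) 1) {σ : Finset ι}
    (hσ : σ ∈ K.faces) :
    (cochainLaw K 0 ν).real {ε | IsNonconstantOn (vertexValue ε) σ} =
      1 - ν ^ #σ - (1 - ν) ^ #σ := by
  have := isProbabilityMeasure_cochainLaw (K := K) 0 hν
  obtain ⟨z, hz⟩ := (K.isRelLowerSet_faces hσ).1
  let constant (c : ZMod 2) : Set (Cochain K 0) := {ε | ∀ x ∈ σ, vertexValue ε x = c}
  have measurable (A : Set (Cochain K 0)) : MeasurableSet A := A.toFinite.measurableSet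
  have nonconstant_eq :
      {ε : Cochain K 0 | IsNonconstantOn (vertexValue ε) σ} = (constant 0 ∪ constant 1)ᶜ := by
    ext ε
    simp only [constant, Set.mem_compl_iff, Set.mem_union, Set.mem_ofPred_eq]
    constructor
    · rintro ⟨x, hx, y, hy, hxy⟩ (h | h)
      all_goals exact hxy ((h x hx).trans (h y hy).symm)
    · intro h
      have zero_or_one : ∀ a : ZMod 2, a = 0 ∨ a = 1 := by decide
      by_contra hconst
      have eq_z : ∀ x ∈ σ, vertexValue ε x = vertexValue ε z := fun x hx =>
        by_contra fun hxz => hconst ⟨x, hx, z, hz, hxz⟩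
      exact h ((zero_or_one (vertexValue ε z)).imp (fun hz x hx => (eq_z x hx).trans hz)
        fun hz x hx => (eq_z x hx).trans hz)
  have disjoint : Disjoint (constant 0) (constant 1) :=
    Set.disjoint_left.2 fun ε h₀ h₁ => zero_ne_one ((h₀ z hz).symm.trans (h₁ z hz))
  rw [nonconstant_eq, probReal_compl_eq_one_sub (measurable _),
    measureReal_union disjoint (measurable _), cochainLaw_real_constant hν hσ,
    cochainLaw_real_constant hν hσ, bernoulliLaw_real_zero hν, bernoulliLaw_real_one hν, sub_sub]

theorem integral_sum_nonconstantFaces (hν : ν ∈ Set.Icc (0 : ℝ) 1) {F : Finset (Finset ι)}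
    (hF : ∀ σ ∈ F, σ ∈ K.faces) (g : Finset ι → ℝ) :
    ∫ ε : Cochain K 0, ∑ σ ∈ nonconstantFaces F ε, g σ ∂(cochainLaw K 0 ν) =
      ∑ σ ∈ F, (1 - ν ^ #σ - (1 - ν) ^ #σ) * g σ := by
  have := isProbabilityMeasure_cochainLaw (K := K) 0 hν
  simp only [nonconstantFaces, sum_filter]
  rw [integral_finsetSum _ fun σ _ => Integrable.of_finite]
  refine sum_congr rfl fun σ hσ => ?_
  rw [← cochainLaw_real_nonconstant hν (hF σ hσ), ← smul_eq_mul,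
    ← integral_indicator_const _ (Set.toFinite _).measurableSet]
  simp only [Set.indicator_apply, Set.mem_ofPred_eq]

theorem expectedBetti_le (hν : ν ∈ Set.Icc (0 : ℝ) 1) (i : ℕ) :
    expectedBetti K 0 ν i ≤
      (faceNumber K (i + 1) : ℝ) * (1 - ν ^ (i + 2) - (1 - ν) ^ (i + 2)) := by
  have := isProbabilityMeasure_cochainLaw (K := K) 0 hν
  let F := (Set.toFinite K.faces).toFinset
  have hF : ∀ s, s ∈ F ↔ s ∈ K.faces := fun s => Set.Finite.mem_toFinset _
  calc expectedBetti K 0 ν i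
      ≤ ∫ ε : Cochain K 0, ∑ σ ∈ nonconstantFaces (F.slice (i + 2)) ε, 1 ∂(cochainLaw K 0 ν) := by
        refine integral_mono Integrable.of_finite Integrable.of_finite fun ε => ?_
        simpa using betti_dualSubcomplex_le hF ε i
    _ = ∑ σ ∈ F.slice (i + 2), (1 - ν ^ #σ - (1 - ν) ^ #σ) * 1 :=
        integral_sum_nonconstantFaces hν (fun σ hσ => (hF σ).1 (mem_slice.1 hσ).1) _
    _ = (faceNumber K (i + 1) : ℝ) * (1 - ν ^ (i + 2) - (1 - ν) ^ (i + 2)) := by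
        rw [faceNumber_eq hF, ← nsmul_eq_mul]
        refine sum_eq_card_nsmul fun σ hσ => ?_
        rw [(mem_slice.1 hσ).2, mul_one]

theorem expectedEulerChar_add (hν : ν ∈ Set.Icc (0 : ℝ) 1) {n : ℕ}
    (hn : ∀ σ ∈ K.faces, #σ ≤ n + 1) :
    expectedEulerChar K 0 ν + (eulerChar K : ℝ) =
      ∑ i ∈ range (n + 1), (-1 : ℝ) ^ i * (ν ^ (i + 1) + (1 - ν) ^ (i + 1)) *
        (faceNumber K i : ℝ) := by
  let F := (Set.toFinite K.faces).toFinset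
  have hF : ∀ s, s ∈ F ↔ s ∈ K.faces := fun s => Set.Finite.mem_toFinset _
  have card_lt : ∀ s ∈ F, #s < n + 2 := fun s hs => Nat.lt_succ_of_le (hn s ((hF s).1 hs))
  have expected_eq : expectedEulerChar K 0 ν =
      ∑ σ ∈ F, (1 - ν ^ #σ - (1 - ν) ^ #σ) * (-1) ^ #σ := by
    rw [← integral_sum_nonconstantFaces hν fun σ => (hF σ).1]
    simp only [expectedEulerChar, eulerChar_dualSubcomplex hF, signedCard]
    push_cast
    rfl
  have eulerChar_eq : (eulerChar K : ℝ) = -∑ σ ∈ F, (-1) ^ #σ := by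
    rw [eulerChar_eq_neg_signedCard hF, signedCard]
    push_cast
    rfl
  calc expectedEulerChar K 0 ν + (eulerChar K : ℝ)
      = ∑ σ ∈ F, -(-1) ^ #σ * (ν ^ #σ + (1 - ν) ^ #σ) := by
        rw [expected_eq, eulerChar_eq, ← sum_neg_distrib, ← sum_add_distrib]
        exact sum_congr rfl fun σ _ => by ring
    _ = ∑ d ∈ range (n + 2), #(F.slice d) • (-(-1) ^ d * (ν ^ d + (1 - ν) ^ d)) :=
        sum_slice card_lt fun d => -(-1 : ℝ) ^ d * (ν ^ d + (1 - ν) ^ d)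
    _ = _ := by
        rw [sum_range_succ', slice_zero_eq_empty hF, card_empty, zero_smul, add_zero]
        refine sum_congr rfl fun i _ => ?_
        rw [faceNumber_eq hF, nsmul_eq_mul, pow_succ (-1 : ℝ) i]
        ring

end Probability

end RandomSubcomplex

theorem mainTheorem2 {ι : Type*} (K : PreAbstractSimplicialComplex ι) [Finite K.faces]
    (n : ℕ) (hn : RandomSubcomplex.HasDimension K n) (ν : ℝ) (hν : ν ∈ Set.Icc (0 : ℝ) 1) :
    (∀ i : ℕ, i < n →
      RandomSubcomplex.expectedBetti K 0 ν i ≤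
        (RandomSubcomplex.faceNumber K (i + 1) : ℝ) *
          (1 - ν ^ (i + 2) - (1 - ν) ^ (i + 2))) ∧
    RandomSubcomplex.expectedEulerChar K 0 ν + (RandomSubcomplex.eulerChar K : ℝ) =
      ∑ i ∈ Finset.range (n + 1),
        (-1 : ℝ) ^ i * (ν ^ (i + 1) + (1 - ν) ^ (i + 1)) *
          (RandomSubcomplex.faceNumber K i : ℝ) :=
  ⟨fun i _ => RandomSubcomplex.expectedBetti_le hν i,
    RandomSubcomplex.expectedEulerChar_add hν hn.2⟩
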